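/- Let $M_d$ be the algebra of complex $d\times d$ matrices. A quantum channel is a completely positive trace-preserving linear map $\Phi:M_d\to M_{d_{\rm out}}$. Two channels $\Phi:M_d\to M_{d_{\rm out}}$ and $\Phi_c:M_d\to M_{d_{\rm env}}$ are called complementary if there is an isometry $V:\mathbb C^d\to\mathbb C^{d_{\rm out}}\otimes\mathbb C^{d_{\rm env}}$ with $\Phi(X)=\operatorname{Tr}_{\rm env}(VXV^\dagger)$ and $\Phi_c(X)=\operatorname{Tr}_{\rm out}(VXV^\dagger)$ for all $X\in M_d$. The coherent information of a channel $\Phi$ is $$\mathcal Q^{(1)}(\Phi)=\max_{\rho}\bigl[S(\Phi(\rho))-S(\Phi_c(\rho))\bigr],$$ where $\rho$ ranges over the states (positive semidefinite matrices of trace one) in $M_d$, $S(\rho)=-\operatorname{Tr}(\rho\log\rho)$ is the von Neumann entropy, and $\Phi_c$ is any channel complementary to $\Phi$ (the value does not depend on the choice). The quantum capacity of $\Phi$ is $$\mathcal Q(\Phi)=\lim_{n\to\infty}\frac{\mathcal Q^{(1)}(\Phi^{\otimes n})}{n}.$$ **Theorem 4.3.** Let $d\ge 4$ and let $\Phi_{\rm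 WH}:M_d\to M_d$ be the Werner–Holevo channel $$\Phi_{\rm WH}(X)=\frac{\operatorname{Tr}(X)\,\mathbb 1_d-X^{\top}}{d-1}.$$ Then every channel $\Phi_c$ complementary to $\Phi_{\rm WH}$ has positive quantum capacity: the limit $\mathcal Q(\Phi_c)$ exists and $\mathcal Q(\Phi_c)>0$. -/

import Mathlib

open Filter Topology
open scoped ComplexOrder

noncomputable section

namespace QuantumInfo

/-! Matrix algebras are indexed by arbitrary finite types: `Matrix m m ℂ` with `m = Fin d` is the
algebra of complex `d × d` matrices, and `m × n` (or `Fin n → m`) indexes a tensor product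
(or an `n`-fold tensor power). -/

/-- Quantum states: positive semidefinite matrices of unit trace. -/
def IsState {m : Type*} [Fintype m] (ρ : Matrix m m ℂ) : Prop :=
  ρ.PosSemidef ∧ ρ.trace = 1

/-- The map `Φ ⊗ id_k`, which applies `Φ` to each of the `k × k` blocks. -/
def ampliation {m n : Type*} (Φ : Matrix m m ℂ →ₗ[ℂ] Matrix n n ℂ) (k : ℕ)
    (X : Matrix (m × Fin k) (m × Fin k) ℂ) : Matrix (n × Fin k) (n × Fin k) ℂ :=
  Matrix.of fun a b => Φ (Matrix.of fun i j => X (i, a.2) (j, b.2)) a.1 b.1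

/-- Quantum channels: completely positive and trace preserving linear maps. -/
structure IsQuantumChannel {m n : Type*} [Fintype m] [Fintype n]
    (Φ : Matrix m m ℂ →ₗ[ℂ] Matrix n n ℂ) : Prop where
  completelyPositive : ∀ (k : ℕ) (X : Matrix (m × Fin k) (m × Fin k) ℂ),
    X.PosSemidef → (ampliation Φ k X).PosSemidef
  tracePreserving : ∀ X : Matrix m m ℂ, (Φ X).trace = X.trace

/-- The partial trace over the second tensor factor. -/
def traceRight {n e : Type*} [Fintype e] (Y : Matrix (n × e) (n × e) ℂ) : Matrix n n ℂ :=
  Matrix.of fun a b => ∑ k, Y (a, k) (b, k)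

/-- The partial trace over the first tensor factor. -/
def traceLeft {n e : Type*} [Fintype n] (Y : Matrix (n × e) (n × e) ℂ) : Matrix e e ℂ :=
  Matrix.of fun a b => ∑ k, Y (k, a) (k, b)

/-- Two quantum channels `Φ` and `Φc` with a common input space are complementary if there is an
isometry `V` from the input space to the tensor product of the output and environment spaces such
that `Φ` and `Φc` arise from `X ↦ V X V†` by tracing out the environment and the output. -/
def IsComplementary {m n e : Type*} [Fintype m] [DecidableEq m] [Fintype n] [Fintype e]
    (Φ : Matrix m m ℂ →ₗ[ℂ] Matrix n n ℂ) (Φc : Matrix m m ℂ →ₗ[ℂ] Matrix e e ℂ) : Prop :=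
  IsQuantumChannel Φ ∧ IsQuantumChannel Φc ∧
    ∃ V : Matrix (n × e) m ℂ, V.conjTranspose * V = 1 ∧
      ∀ X : Matrix m m ℂ, Φ X = traceRight (V * X * V.conjTranspose) ∧
        Φc X = traceLeft (V * X * V.conjTranspose)

/-- The von Neumann entropy `S(ρ) = -Tr(ρ log ρ)`, with `0 log 0 = 0`; the logarithm of a
Hermitian matrix is taken in the functional calculus. -/
def entropy {m : Type*} [Fintype m] [DecidableEq m] (ρ : Matrix m m ℂ) : ℝ :=
  -(ρ * cfc Real.log ρ).trace.re

/-- The coherent information `I_c(ρ; Φ) = S(Φ(ρ)) - S(Φc(ρ))` of an input `ρ`, where `Φc` is a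
channel complementary to `Φ`. -/
def coherentInfoAt {m n e : Type*} [Fintype n] [DecidableEq n] [Fintype e] [DecidableEq e]
    (Φ : Matrix m m ℂ →ₗ[ℂ] Matrix n n ℂ) (Φc : Matrix m m ℂ →ₗ[ℂ] Matrix e e ℂ)
    (ρ : Matrix m m ℂ) : ℝ :=
  entropy (Φ ρ) - entropy (Φc ρ)

/-- The coherent information `Q⁽¹⁾(Φ)`: the maximum of `I_c(ρ; Φ)` over all states `ρ`.
Complementary channels exist and are all isometrically related, so that `I_c(ρ; Φ)` does not
depend on the choice of `Φc`; hence letting `Φc` range over all of them does not change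
the maximum. -/
def coherentInformation {m n : Type*} [Fintype m] [DecidableEq m] [Fintype n] [DecidableEq n]
    (Φ : Matrix m m ℂ →ₗ[ℂ] Matrix n n ℂ) : ℝ :=
  sSup {x : ℝ | ∃ (e : Type) (_ : Fintype e) (_ : DecidableEq e)
    (Φc : Matrix m m ℂ →ₗ[ℂ] Matrix e e ℂ) (ρ : Matrix m m ℂ),
      IsComplementary Φ Φc ∧ IsState ρ ∧ x = coherentInfoAt Φ Φc ρ}

/-- The tensor power `Φ^{⊗n}`, acting on matrices indexed by `Fin n → m`: the linear map whose
matrix entries in the bases of matrix units are the products of those of `Φ`. -/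
def tensorPower {m m' : Type*} [Fintype m] [DecidableEq m]
    (Φ : Matrix m m ℂ →ₗ[ℂ] Matrix m' m' ℂ) (n : ℕ) :
    Matrix (Fin n → m) (Fin n → m) ℂ →ₗ[ℂ] Matrix (Fin n → m') (Fin n → m') ℂ where
  toFun X := Matrix.of fun a b => ∑ i : Fin n → m, ∑ j : Fin n → m,
    X i j * ∏ k, Φ (Matrix.single (i k) (j k) 1) (a k) (b k)
  map_add' X Y := by
    ext a b
    simp [add_mul, Finset.sum_add_distrib]
  map_smul' c X := by
    ext a b
    simp [Finset.mul_sum, mul_assoc]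

/-- `q` is the quantum capacity `Q(Φ) = lim_{n → ∞} Q⁽¹⁾(Φ^{⊗n}) / n`: the limit exists and is
equal to `q`. -/
def HasQuantumCapacity {m n : Type*} [Fintype m] [DecidableEq m] [Fintype n] [DecidableEq n]
    (Φ : Matrix m m ℂ →ₗ[ℂ] Matrix n n ℂ) (q : ℝ) : Prop :=
  Tendsto (fun N : ℕ => coherentInformation (tensorPower Φ N) / N) atTop (𝓝 q)

/-- The Werner–Holevo channel `X ↦ (Tr(X) 1 - Xᵀ) / (d - 1)` on `d × d` matrices. -/
def wernerHolevo (d : ℕ) : Matrix (Fin d) (Fin d) ℂ →ₗ[ℂ] Matrix (Fin d) (Fin d) ℂ where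
  toFun X := ((d : ℂ) - 1)⁻¹ • (X.trace • (1 : Matrix (Fin d) (Fin d) ℂ) - X.transpose)
  map_add' X Y := by
    rw [← smul_add, Matrix.trace_add, Matrix.transpose_add, add_smul]
    congr 1
    abel
  map_smul' c X := by
    rw [Matrix.trace_smul, Matrix.transpose_smul, RingHom.id_apply, smul_comm c, smul_sub c,
      smul_assoc]

/-- `Φ^{⊗n}` sends `X₁ ⊗ ⋯ ⊗ Xₙ` to `Φ(X₁) ⊗ ⋯ ⊗ Φ(Xₙ)`. -/
theorem tensorPower_prod {m m' : Type*} [Fintype m] [DecidableEq m]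
    (Φ : Matrix m m ℂ →ₗ[ℂ] Matrix m' m' ℂ) (n : ℕ) (X : Fin n → Matrix m m ℂ) :
    tensorPower Φ n (Matrix.of fun i j => ∏ k, X k (i k) (j k)) =
      Matrix.of fun a b => ∏ k, Φ (X k) (a k) (b k) := by
  ext a b
  have h : ∀ k, Φ (X k) (a k) (b k) =
      ∑ i, ∑ j, X k i j * Φ (Matrix.single i j 1) (a k) (b k) := by
    intro k
    conv_lhs => rw [Matrix.matrix_eq_sum_single (X k)]
    simp only [map_sum, Matrix.sum_apply]
    refine Finset.sum_congr rfl fun i _ => Finset.sum_congr rfl fun j _ => ?_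
    have : Matrix.single i j (X k i j) = X k i j • Matrix.single i j (1 : ℂ) := by
      simp
    rw [this, map_smul, Matrix.smul_apply, smul_eq_mul]
  simp only [tensorPower, LinearMap.coe_mk, AddHom.coe_mk, Matrix.of_apply]
  simp only [h]
  rw [Finset.prod_univ_sum, Fintype.piFinset_univ]
  refine Finset.sum_congr rfl fun i _ => ?_
  rw [Finset.prod_univ_sum, Fintype.piFinset_univ]
  exact Finset.sum_congr rfl fun j _ => Finset.prod_mul_distrib.symm

/-- The entropy of a Hermitian matrix in terms of its eigenvalues. -/
theorem entropy_eq_sum {m : Type*} [Fintype m] [DecidableEq m] {ρ : Matrix m m ℂ}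
    (h : ρ.IsHermitian) : entropy ρ = ∑ i, Real.negMulLog (h.eigenvalues i) := by
  have hs : IsSelfAdjoint ρ := h
  have h1 : ρ * cfc Real.log ρ = cfc (fun x : ℝ => x * Real.log x) ρ := by
    have hc : ContinuousOn Real.log (spectrum ℝ ρ) :=
      (Matrix.finite_real_spectrum (A := ρ)).continuousOn _
    rw [cfc_mul (fun x : ℝ => x) Real.log ρ continuousOn_id hc, cfc_id' ℝ ρ]
  rw [entropy, h1, h.cfc_eq, Matrix.IsHermitian.cfc, Unitary.conjStarAlgAut_apply,
    Matrix.trace_mul_cycle, Unitary.coe_star_mul_self, one_mul, Matrix.trace_diagonal,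
    Complex.re_sum, ← Finset.sum_neg_distrib]
  exact Finset.sum_congr rfl fun i _ => by simp [Real.negMulLog]

/-- A pair of linear maps obtained from an isometry by partial traces consists of channels. -/
theorem isComplementary_of_isometry {m n e : Type*} [Fintype m] [DecidableEq m] [Fintype n]
    [Fintype e] {Φ : Matrix m m ℂ →ₗ[ℂ] Matrix n n ℂ} {Φc : Matrix m m ℂ →ₗ[ℂ] Matrix e e ℂ}
    (V : Matrix (n × e) m ℂ) (hV : V.conjTranspose * V = 1)
    (h : ∀ X : Matrix m m ℂ, Φ X = traceRight (V * X * V.conjTranspose))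
    (hc : ∀ X : Matrix m m ℂ, Φc X = traceLeft (V * X * V.conjTranspose)) : IsComplementary Φ Φc := by
  have htr : ∀ X : Matrix m m ℂ, (V * X * V.conjTranspose).trace = X.trace := fun X => by
    rw [Matrix.trace_mul_cycle, hV, one_mul]
  refine ⟨⟨fun k X hX => ?_, fun X => ?_⟩, ⟨fun k X hX => ?_, fun X => ?_⟩, V, hV,
    fun X => ⟨h X, hc X⟩⟩
  · have : ampliation Φ k X = ∑ c : e,
        (Matrix.of fun (a : n × Fin k) (i : m × Fin k) => if a.2 = i.2 then V (a.1, c) i.1 else 0) *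
          X * (Matrix.of fun (a : n × Fin k) (i : m × Fin k) =>
            if a.2 = i.2 then V (a.1, c) i.1 else 0).conjTranspose := by
      ext a b
      simp only [ampliation, h, traceRight, Matrix.of_apply, Matrix.mul_apply, Matrix.sum_apply,
        Matrix.conjTranspose_apply, Fintype.sum_prod_type, ite_mul, zero_mul, apply_ite star,
        star_zero, mul_ite, mul_zero, Finset.sum_ite_eq, Finset.mem_univ, if_true]
    rw [this]
    exact Matrix.posSemidef_sum _ fun c _ => hX.mul_mul_conjTranspose_same _
  · rw [← htr X, h]
    simp [Matrix.trace, traceRight, Fintype.sum_prod_type]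
  · have : ampliation Φc k X = ∑ c : n,
        (Matrix.of fun (a : e × Fin k) (i : m × Fin k) => if a.2 = i.2 then V (c, a.1) i.1 else 0) *
          X * (Matrix.of fun (a : e × Fin k) (i : m × Fin k) =>
            if a.2 = i.2 then V (c, a.1) i.1 else 0).conjTranspose := by
      ext a b
      simp only [ampliation, hc, traceLeft, Matrix.of_apply, Matrix.mul_apply, Matrix.sum_apply,
        Matrix.conjTranspose_apply, Fintype.sum_prod_type, ite_mul, zero_mul, apply_ite star,
        star_zero, mul_ite, mul_zero, Finset.sum_ite_eq, Finset.mem_univ, if_true]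
    rw [this]
    exact Matrix.posSemidef_sum _ fun c _ => hX.mul_mul_conjTranspose_same _
  · rw [← htr X, hc]
    simp only [Matrix.trace, Matrix.diag, traceLeft, Matrix.of_apply, Fintype.sum_prod_type]
    exact Finset.sum_comm

end QuantumInfo

end

/-! A single use of `Φc` on the maximally mixed state already shows positivity. The Werner–Holevo
channel is unital, so its output there is `1/d`, of entropy `log d`. Its Choi matrix is a multiple
of `1 - F`, with `F` the flip, hence of an antisymmetric projection. The output of `Φc` at `1` has
the same nonzero spectrum as the Choi matrix, being `Aᴴ * A` against `(A * Aᴴ)ᵀ`, so on the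
maximally mixed state `Φc` outputs a flat state of entropy `log (d(d-1)/2)`. The coherent
information of `Φc` is therefore at least `log ((d-1)/2)`, positive once `d > 3`.

To pass to the capacity, `coherentInformation_add_le` shows superadditivity over tensor powers, from
product inputs and additivity of entropy (`entropy_kronecker`). Fekete's lemma then gives, in
`exists_hasQuantumCapacity`, a limit that dominates the one-use value. -/

namespace QuantumInfo

open Matrix
open scoped Kronecker

/-! ### States. -/

section State

variable {m n : Type*} [Fintype m] [Fintype n]

theorem IsState.card_pos {ρ : Matrix m m ℂ} (h : IsState ρ) : 0 < Fintype.card m := by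
  rw [Fintype.card_pos_iff]
  by_contra hm
  rw [not_nonempty_iff] at hm
  simpa [Matrix.trace] using h.2

theorem IsState.kronecker {ρ : Matrix m m ℂ} {σ : Matrix n n ℂ} (hρ : IsState ρ)
    (hσ : IsState σ) : IsState (ρ ⊗ₖ σ) :=
  ⟨hρ.1.kronecker hσ.1, by rw [trace_kronecker, hρ.2, hσ.2, one_mul]⟩

theorem IsState.submatrix_equiv {ρ : Matrix m m ℂ} (h : IsState ρ) (e : n ≃ m) :
    IsState (ρ.submatrix e e) :=
  ⟨h.1.submatrix e, by
    rw [← h.2]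
    exact Equiv.sum_comp e fun i => ρ i i⟩

end State

/-! ### Von Neumann entropy: bounds, additivity, flat spectra. -/

/-- The entropy depends only on the characteristic polynomial. -/
theorem entropy_eq_sum_of_charpoly {m n : Type*} [Fintype m] [DecidableEq m]
    [Fintype n] {ρ : Matrix m m ℂ} (h : ρ.IsHermitian) (f : n → ℝ)
    (hf : ρ.charpoly = ∏ i, (Polynomial.X - Polynomial.C (f i : ℂ))) :
    entropy ρ = ∑ i, Real.negMulLog (f i) := by
  have h1 : Multiset.map (fun i => (h.eigenvalues i : ℂ)) Finset.univ.val =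
      Multiset.map (fun i => (f i : ℂ)) Finset.univ.val := by
    have h2 := h.roots_charpoly_eq_eigenvalues
    rw [hf, Polynomial.roots_prod _ _
      (by simp [Finset.prod_ne_zero_iff, Polynomial.X_sub_C_ne_zero])] at h2
    simpa [Function.comp_def] using h2.symm
  rw [entropy_eq_sum h]
  have h3 := congrArg (fun s => (s.map fun z : ℂ => Real.negMulLog z.re).sum) h1
  simpa [Multiset.map_map, Function.comp_def] using h3

section Entropy

variable {m n : Type*} [Fintype m] [DecidableEq m] [Fintype n] [DecidableEq n]

theorem IsState.sum_eigenvalues {ρ : Matrix m m ℂ} (h : IsState ρ) :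
    ∑ i, h.1.1.eigenvalues i = 1 := by
  have := h.1.1.trace_eq_sum_eigenvalues
  have h1 : (1 : ℂ) = ∑ i, (h.1.1.eigenvalues i : ℂ) := h.2.symm.trans this
  exact_mod_cast h1.symm

theorem IsState.entropy_nonneg {ρ : Matrix m m ℂ} (h : IsState ρ) : 0 ≤ entropy ρ := by
  rw [entropy_eq_sum h.1.1]
  refine Finset.sum_nonneg fun i _ => Real.negMulLog_nonneg (h.1.eigenvalues_nonneg i) ?_
  rw [← h.sum_eigenvalues]
  exact Finset.single_le_sum (fun j _ => h.1.eigenvalues_nonneg j) (Finset.mem_univ i)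

theorem IsState.entropy_le_log_card {ρ : Matrix m m ℂ} (h : IsState ρ) :
    entropy ρ ≤ Real.log (Fintype.card m) := by
  set D : ℝ := (Fintype.card m : ℝ) with hD
  have hDpos : 0 < D := Nat.cast_pos.2 h.card_pos
  -- This is `log t ≤ t - 1` at `t = 1/(xD)`, multiplied by `x`; the corrections `D⁻¹ - x` sum to
  -- zero over the spectrum.
  have key : ∀ x : ℝ, 0 ≤ x → Real.negMulLog x ≤ x * Real.log D + (D⁻¹ - x) := by
    intro x hx
    rcases hx.eq_or_lt with rfl | hx
    · simp [hDpos.le]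
    · have h1 := Real.log_le_sub_one_of_pos (inv_pos.2 (mul_pos hx hDpos))
      rw [Real.log_inv, Real.log_mul hx.ne' hDpos.ne'] at h1
      have h2 := mul_le_mul_of_nonneg_left h1 hx.le
      have h3 : x * ((x * D)⁻¹ - 1) = D⁻¹ - x := by field_simp
      rw [h3] at h2
      rw [Real.negMulLog]
      linarith
  rw [entropy_eq_sum h.1.1]
  refine (Finset.sum_le_sum fun i _ => key _ (h.1.eigenvalues_nonneg i)).trans (le_of_eq ?_)
  rw [Finset.sum_add_distrib, Finset.sum_sub_distrib, ← Finset.sum_mul, h.sum_eigenvalues]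
  simp [← hD, hDpos.ne']

theorem entropy_submatrix_equiv {ρ : Matrix m m ℂ} (h : ρ.IsHermitian) (e : n ≃ m) :
    entropy (ρ.submatrix e e) = entropy ρ := by
  rw [entropy_eq_sum h, entropy_eq_sum_of_charpoly (h.submatrix e) h.eigenvalues]
  have := charpoly_reindex e.symm ρ
  rw [reindex_apply, Equiv.symm_symm] at this
  rw [this, h.charpoly_eq]
  rfl

/-- Diagonalising both factors shows that the spectrum is the set of products `p i * q j`;
additivity follows since each spectrum sums to `1`. -/
theorem entropy_kronecker {ρ : Matrix m m ℂ} {σ : Matrix n n ℂ} (hρ : IsState ρ)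
    (hσ : IsState σ) : entropy (ρ ⊗ₖ σ) = entropy ρ + entropy σ := by
  set p := hρ.1.1.eigenvalues with hp
  set q := hσ.1.1.eigenvalues with hq
  have hcp : (ρ ⊗ₖ σ).charpoly =
      ∏ i : m × n, (Polynomial.X - Polynomial.C ((p i.1 * q i.2 : ℝ) : ℂ)) := by
    set U := (hρ.1.1.eigenvectorUnitary : Matrix m m ℂ)
    set W := (hσ.1.1.eigenvectorUnitary : Matrix n n ℂ)
    have hUU : star U * U = 1 := Unitary.coe_star_mul_self _
    have hWW : star W * W = 1 := Unitary.coe_star_mul_self _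
    have h1 : ρ = U * diagonal (fun i => (p i : ℂ)) * star U := by
      conv_lhs => rw [hρ.1.1.spectral_theorem, Unitary.conjStarAlgAut_apply]
      rfl
    have h2 : σ = W * diagonal (fun i => (q i : ℂ)) * star W := by
      conv_lhs => rw [hσ.1.1.spectral_theorem, Unitary.conjStarAlgAut_apply]
      rfl
    rw [h1, h2, mul_kronecker_mul, charpoly_mul_comm, mul_kronecker_mul, ← mul_assoc,
      ← mul_kronecker_mul, hUU, hWW, one_kronecker_one, one_mul, diagonal_kronecker_diagonal,
      charpoly_diagonal]
    simp
  rw [entropy_eq_sum_of_charpoly (hρ.1.kronecker hσ.1).1 _ hcp, entropy_eq_sum hρ.1.1,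
    entropy_eq_sum hσ.1.1, Fintype.sum_prod_type]
  simp only [Real.negMulLog_mul, Finset.sum_add_distrib, ← Finset.mul_sum, ← Finset.sum_mul]
  rw [← hp, ← hq, show ∑ i, p i = 1 from hρ.sum_eigenvalues,
    show ∑ i, q i = 1 from hσ.sum_eigenvalues]
  ring

/-- A state whose nonzero eigenvalues all equal `c` has entropy `-log c`. -/
theorem IsState.entropy_eq_neg_log {ρ : Matrix m m ℂ} (h : IsState ρ) {c : ℝ}
    (hc : ρ * ρ * ρ = (c : ℂ) • (ρ * ρ)) : entropy ρ = -Real.log c := by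
  -- An eigenvalue `x` satisfies `x³ = c x²`. The cubic form of the hypothesis suits `Aᴴ * A` when a
  -- quadratic relation is known only for `A * Aᴴ`.
  have key : ∀ i, h.1.1.eigenvalues i = 0 ∨ h.1.1.eigenvalues i = c := by
    intro i
    set x := h.1.1.eigenvalues i with hx
    set v : m → ℂ := ⇑(h.1.1.eigenvectorBasis i) with hv
    have hv0 : v ≠ 0 := (WithLp.ofLp_eq_zero 2).ne.2 (h.1.1.eigenvectorBasis.orthonormal.ne_zero i)
    have h1 : ρ *ᵥ v = (x : ℂ) • v := by
      rw [hv, h.1.1.mulVec_eigenvectorBasis, ← hx]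
      rfl
    have h2 := congrArg (fun M => M *ᵥ v) hc
    simp only [smul_mulVec, ← mulVec_mulVec, h1, mulVec_smul, smul_smul] at h2
    rw [← sub_eq_zero, ← sub_smul] at h2
    have h3 := (smul_eq_zero.1 h2).resolve_right hv0
    have h4 : x * x * (x - c) = 0 := by
      have : ((x * x * (x - c) : ℝ) : ℂ) = 0 := by
        push_cast
        linear_combination h3
      exact_mod_cast this
    rcases mul_eq_zero.1 h4 with h5 | h5
    · exact Or.inl (mul_self_eq_zero.1 h5)
    · exact Or.inr (sub_eq_zero.1 h5)
  rw [entropy_eq_sum h.1.1]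
  have : ∀ i, Real.negMulLog (h.1.1.eigenvalues i) = h.1.1.eigenvalues i * -Real.log c := by
    intro i
    rcases key i with h0 | h0 <;> simp [h0, Real.negMulLog]
  rw [Finset.sum_congr rfl fun i _ => this i, ← Finset.sum_mul, h.sum_eigenvalues, one_mul]

end Entropy

/-! ### Partial traces, isometries and tensor powers of complementary pairs. -/

section PartialTrace

variable {m n e : Type*}

theorem posSemidef_traceRight [Fintype e] {Y : Matrix (n × e) (n × e) ℂ} (h : Y.PosSemidef) :
    (traceRight Y).PosSemidef := by
  have : traceRight Y = ∑ k, Y.submatrix (fun a => (a, k)) (fun a => (a, k)) := by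
    ext a b
    simp [traceRight, Matrix.sum_apply]
  rw [this]
  exact posSemidef_sum _ fun k _ => h.submatrix _

theorem traceLeft_eq_traceRight_swap [Fintype n] (Y : Matrix (n × e) (n × e) ℂ) :
    traceLeft Y = traceRight (Y.submatrix (Equiv.prodComm e n) (Equiv.prodComm e n)) := rfl

theorem traceRight_eq_traceLeft_swap [Fintype e] (Y : Matrix (n × e) (n × e) ℂ) :
    traceRight Y = traceLeft (Y.submatrix (Equiv.prodComm e n) (Equiv.prodComm e n)) := rfl


theorem traceRight_mul_mul_conjTranspose [Fintype m] [Fintype e] (V : Matrix (n × e) m ℂ) (X : Matrix m m ℂ) (a b : n) :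
    traceRight (V * X * Vᴴ) a b =
      ∑ i, ∑ j, X i j * ∑ c, V (a, c) i * star (V (b, c) j) := by
  simp only [traceRight, of_apply, mul_apply, conjTranspose_apply, Finset.sum_mul, Finset.mul_sum]
  rw [Finset.sum_comm_cycle]
  refine Finset.sum_congr rfl fun i _ => ?_
  rw [Finset.sum_comm]
  refine Finset.sum_congr rfl fun j _ => Finset.sum_congr rfl fun c _ => ?_
  ring

theorem tensorPower_single [Fintype m] [DecidableEq m] (Φ : Matrix m m ℂ →ₗ[ℂ] Matrix n n ℂ) (N : ℕ) (i j : Fin N → m)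
    (a b : Fin N → n) :
    tensorPower Φ N (single i j 1) a b = ∏ k, Φ (single (i k) (j k) 1) (a k) (b k) := by
  have : single i j (1 : ℂ) = of fun i' j' => ∏ k, single (i k) (j k) (1 : ℂ) (i' k) (j' k) := by
    ext i' j'
    simp only [of_apply, single_apply, Finset.prod_ite_zero, Finset.prod_const_one, funext_iff,
      forall_and, Finset.mem_univ, true_imp_iff]
  rw [this, tensorPower_prod, of_apply]

theorem sum_prod_apply_apply [Fintype e] {R : Type*} [CommSemiring R] (N : ℕ) (f : Fin N → e → R) :
    ∑ c : Fin N → e, ∏ k, f k (c k) = ∏ k, ∑ c, f k c := by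
  classical
  rw [Finset.prod_univ_sum, Fintype.piFinset_univ]

theorem apply_single_of_traceRight [Fintype m] [DecidableEq m] [Fintype e]
    {Φ : Matrix m m ℂ →ₗ[ℂ] Matrix n n ℂ} {V : Matrix (n × e) m ℂ}
    (h : ∀ X, Φ X = traceRight (V * X * Vᴴ)) (i j : m) (a b : n) :
    Φ (single i j 1) a b = ∑ c, V (a, c) i * star (V (b, c) j) := by
  rw [h, traceRight_mul_mul_conjTranspose, Finset.sum_eq_single i, Finset.sum_eq_single j]
  · simp
  · intro j' _ hj
    simp [single_apply_of_col_ne _ _ hj.symm]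
  · simp
  · intro i' _ hi
    refine Finset.sum_eq_zero fun j' _ => ?_
    simp [single_apply_of_row_ne hi.symm]
  · simp

/-- By linearity, a dilation needs checking only on matrix units, where tensor products of channels
are products of scalars. -/
theorem eq_traceRight_of_apply_single [Fintype m] [DecidableEq m] [Fintype e]
    {Φ : Matrix m m ℂ →ₗ[ℂ] Matrix n n ℂ}
    {V : Matrix (n × e) m ℂ}
    (h : ∀ i j a b, Φ (single i j 1) a b = ∑ c, V (a, c) i * star (V (b, c) j))
    (X : Matrix m m ℂ) : Φ X = traceRight (V * X * Vᴴ) := by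
  ext a b
  rw [traceRight_mul_mul_conjTranspose]
  conv_lhs => rw [matrix_eq_sum_single X]
  simp only [map_sum, Matrix.sum_apply]
  refine Finset.sum_congr rfl fun i _ => Finset.sum_congr rfl fun j _ => ?_
  have : single i j (X i j) = X i j • single i j (1 : ℂ) := by simp
  rw [this, map_smul, Matrix.smul_apply, smul_eq_mul, h]

/-- The tensor power of an operator into a tensor product, with the factors regrouped. -/
def isometryPower (V : Matrix (n × e) m ℂ) (N : ℕ) :
    Matrix ((Fin N → n) × (Fin N → e)) (Fin N → m) ℂ :=
  of fun p i => ∏ k, V (p.1 k, p.2 k) (i k)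

theorem isometryPower_isometry [DecidableEq m] [Fintype n] [Fintype e]
    {V : Matrix (n × e) m ℂ} (hV : Vᴴ * V = 1) (N : ℕ) :
    (isometryPower V N)ᴴ * isometryPower V N = 1 := by
  ext i j
  have h1 : ∀ k, ∑ a, ∑ c, star (V (a, c) (i k)) * V (a, c) (j k) = if i k = j k then 1 else 0 := by
    intro k
    have := congrFun (congrFun hV (i k)) (j k)
    rwa [mul_apply, Fintype.sum_prod_type, one_apply] at this
  simp only [mul_apply, conjTranspose_apply, isometryPower, of_apply, Fintype.sum_prod_type,
    star_prod, ← Finset.prod_mul_distrib]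
  rw [Finset.sum_congr rfl fun a _ => sum_prod_apply_apply N
      fun k c => star (V (a k, c) (i k)) * V (a k, c) (j k),
    sum_prod_apply_apply N fun k a => ∑ c, star (V (a, c) (i k)) * V (a, c) (j k)]
  simp only [h1, one_apply, Finset.prod_ite_zero, Finset.prod_const_one, funext_iff,
    Finset.mem_univ, true_imp_iff]

theorem tensorPower_eq_traceRight [Fintype m] [DecidableEq m] [Fintype e]
    {Φ : Matrix m m ℂ →ₗ[ℂ] Matrix n n ℂ} {V : Matrix (n × e) m ℂ}
    (h : ∀ X, Φ X = traceRight (V * X * Vᴴ)) (N : ℕ) (X : Matrix (Fin N → m) (Fin N → m) ℂ) :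
    tensorPower Φ N X = traceRight (isometryPower V N * X * (isometryPower V N)ᴴ) := by
  refine eq_traceRight_of_apply_single (fun i j a b => ?_) X
  simp only [tensorPower_single, apply_single_of_traceRight h, isometryPower, of_apply, star_prod,
    ← Finset.prod_mul_distrib]
  rw [sum_prod_apply_apply N fun k c => V (a k, c) (i k) * star (V (b k, c) (j k))]

variable [Fintype m] [DecidableEq m] [Fintype n] [Fintype e]

theorem IsComplementary.symm {Φ : Matrix m m ℂ →ₗ[ℂ] Matrix n n ℂ}
    {Φc : Matrix m m ℂ →ₗ[ℂ] Matrix e e ℂ} (h : IsComplementary Φ Φc) : IsComplementary Φc Φ := by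
  obtain ⟨h1, h2, V, hV, h3⟩ := h
  have hsub : ∀ X : Matrix m m ℂ, V.submatrix (Equiv.prodComm e n) id * X *
      (V.submatrix (Equiv.prodComm e n) id)ᴴ =
        (V * X * Vᴴ).submatrix (Equiv.prodComm e n) (Equiv.prodComm e n) := fun X => rfl
  refine ⟨h2, h1, V.submatrix (Equiv.prodComm e n) id, ?_, fun X => ⟨?_, ?_⟩⟩
  · rw [conjTranspose_submatrix, submatrix_mul_equiv, hV, submatrix_id_id]
  · rw [hsub, (h3 X).2, traceLeft_eq_traceRight_swap]
  · rw [hsub, (h3 X).1, traceRight_eq_traceLeft_swap]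

theorem IsComplementary.isState {Φ : Matrix m m ℂ →ₗ[ℂ] Matrix n n ℂ}
    {Φc : Matrix m m ℂ →ₗ[ℂ] Matrix e e ℂ} (h : IsComplementary Φ Φc) {ρ : Matrix m m ℂ}
    (hρ : IsState ρ) : IsState (Φ ρ) := by
  refine ⟨?_, by rw [h.1.tracePreserving, hρ.2]⟩
  obtain ⟨-, -, V, -, h3⟩ := h
  rw [(h3 ρ).1]
  exact posSemidef_traceRight (hρ.1.mul_mul_conjTranspose_same V)

/-- Tensor powers of complementary channels are complementary. -/
theorem IsComplementary.tensorPower {Φ : Matrix m m ℂ →ₗ[ℂ] Matrix n n ℂ}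
    {Φc : Matrix m m ℂ →ₗ[ℂ] Matrix e e ℂ} (h : IsComplementary Φ Φc) (N : ℕ) :
    IsComplementary (tensorPower Φ N) (tensorPower Φc N) := by
  obtain ⟨-, -, V, hV, h3⟩ := h
  refine isComplementary_of_isometry (isometryPower V N) (isometryPower_isometry hV N)
    (tensorPower_eq_traceRight (fun X => (h3 X).1) N) fun X => ?_
  -- Swapping output and environment lets the same lemma serve for both partial traces.
  have h4 : ∀ X, Φc X = traceRight (V.submatrix (Equiv.prodComm e n) id * X *
      (V.submatrix (Equiv.prodComm e n) id)ᴴ) := fun X => (h3 X).2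
  rw [tensorPower_eq_traceRight h4]
  rfl

end PartialTrace

/-! ### Complementary channels of tensor products. -/

section Product

variable {m n m₁ n₁ e₁ m₂ n₂ e₂ : Type*}

theorem traceRight_kronecker_submatrix [Fintype e₁] [Fintype e₂] (fn : n ≃ n₁ × n₂)
    (Y₁ : Matrix (n₁ × e₁) (n₁ × e₁) ℂ) (Y₂ : Matrix (n₂ × e₂) (n₂ × e₂) ℂ) :
    traceRight ((Y₁ ⊗ₖ Y₂).submatrix
      ((fn.prodCongr (Equiv.refl (e₁ × e₂))).trans (Equiv.prodProdProdComm n₁ n₂ e₁ e₂))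
      ((fn.prodCongr (Equiv.refl (e₁ × e₂))).trans (Equiv.prodProdProdComm n₁ n₂ e₁ e₂))) =
      (traceRight Y₁ ⊗ₖ traceRight Y₂).submatrix fn fn := by
  ext a b
  simp [traceRight, Fintype.sum_prod_type, Finset.sum_mul_sum]

theorem traceLeft_kronecker_submatrix [Fintype n] [Fintype n₁] [Fintype n₂] (fn : n ≃ n₁ × n₂)
    (Y₁ : Matrix (n₁ × e₁) (n₁ × e₁) ℂ) (Y₂ : Matrix (n₂ × e₂) (n₂ × e₂) ℂ) :
    traceLeft ((Y₁ ⊗ₖ Y₂).submatrix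
      ((fn.prodCongr (Equiv.refl (e₁ × e₂))).trans (Equiv.prodProdProdComm n₁ n₂ e₁ e₂))
      ((fn.prodCongr (Equiv.refl (e₁ × e₂))).trans (Equiv.prodProdProdComm n₁ n₂ e₁ e₂))) =
      traceLeft Y₁ ⊗ₖ traceLeft Y₂ := by
  ext a b
  simp only [traceLeft, of_apply, submatrix_apply, kroneckerMap_apply, Equiv.trans_apply,
    Equiv.prodCongr_apply, Prod.map, Equiv.refl_apply, Equiv.prodProdProdComm_apply,
    Finset.sum_mul_sum]
  rw [← Fintype.sum_prod_type'
    (f := fun k l => Y₁ (k, a.1) (k, b.1) * Y₂ (l, a.2) (l, b.2))]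
  exact Equiv.sum_comp fn fun p => Y₁ (p.1, a.1) (p.1, b.1) * Y₂ (p.2, a.2) (p.2, b.2)

variable [Fintype m] [DecidableEq m] [Fintype n] [Fintype m₁] [DecidableEq m₁] [Fintype n₁]
  [Fintype e₁] [Fintype m₂] [DecidableEq m₂] [Fintype n₂] [Fintype e₂]

/-- A channel that factors as a tensor product has a complementary channel that factors as the
tensor product of given complementary channels of the factors. -/
theorem IsComplementary.exists_kronecker {Φ₁ : Matrix m₁ m₁ ℂ →ₗ[ℂ] Matrix n₁ n₁ ℂ}
    {Ψ₁ : Matrix m₁ m₁ ℂ →ₗ[ℂ] Matrix e₁ e₁ ℂ} {Φ₂ : Matrix m₂ m₂ ℂ →ₗ[ℂ] Matrix n₂ n₂ ℂ}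
    {Ψ₂ : Matrix m₂ m₂ ℂ →ₗ[ℂ] Matrix e₂ e₂ ℂ} (h₁ : IsComplementary Φ₁ Ψ₁)
    (h₂ : IsComplementary Φ₂ Ψ₂) (Φ : Matrix m m ℂ →ₗ[ℂ] Matrix n n ℂ) (fm : m ≃ m₁ × m₂)
    (fn : n ≃ n₁ × n₂)
    (hΦ : ∀ i j a b, Φ (single i j 1) a b =
      Φ₁ (single (fm i).1 (fm j).1 1) (fn a).1 (fn b).1 *
        Φ₂ (single (fm i).2 (fm j).2 1) (fn a).2 (fn b).2) :
    ∃ Ψ : Matrix m m ℂ →ₗ[ℂ] Matrix (e₁ × e₂) (e₁ × e₂) ℂ, IsComplementary Φ Ψ ∧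
      ∀ (ρ₁ : Matrix m₁ m₁ ℂ) (ρ₂ : Matrix m₂ m₂ ℂ),
         Φ ((ρ₁ ⊗ₖ ρ₂).submatrix fm fm) = (Φ₁ ρ₁ ⊗ₖ Φ₂ ρ₂).submatrix fn fn ∧
        Ψ ((ρ₁ ⊗ₖ ρ₂).submatrix fm fm) = Ψ₁ ρ₁ ⊗ₖ Ψ₂ ρ₂ := by
  obtain ⟨-, -, V₁, hV₁, hc₁⟩ := h₁
  obtain ⟨-, -, V₂, hV₂, hc₂⟩ := h₂
  -- `s` regroups `n × (e₁ × e₂)` as `(n₁ × e₁) × (n₂ × e₂)`, so that `V₁ ⊗ₖ V₂` becomes an isometry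
  -- into output times environment.
  set s := (fn.prodCongr (Equiv.refl (e₁ × e₂))).trans (Equiv.prodProdProdComm n₁ n₂ e₁ e₂) with hs
  set W : Matrix (n × (e₁ × e₂)) m ℂ := (V₁ ⊗ₖ V₂).submatrix s fm with hW
  have hWW : Wᴴ * W = 1 := by
    rw [hW, conjTranspose_submatrix, submatrix_mul_equiv, conjTranspose_kronecker,
      ← mul_kronecker_mul, hV₁, hV₂, one_kronecker_one, submatrix_one_equiv]
  have hΦW : ∀ X, Φ X = traceRight (W * X * Wᴴ) := by
    refine eq_traceRight_of_apply_single fun i j a b => ?_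
    rw [hΦ, apply_single_of_traceRight (fun X => (hc₁ X).1),
      apply_single_of_traceRight (fun X => (hc₂ X).1), Finset.sum_mul_sum, Fintype.sum_prod_type]
    refine Finset.sum_congr rfl fun c _ => Finset.sum_congr rfl fun c' _ => ?_
    simp only [hW, hs, submatrix_apply, kroneckerMap_apply, Equiv.trans_apply,
      Equiv.prodCongr_apply, Prod.map, Equiv.refl_apply, Equiv.prodProdProdComm_apply, star_mul']
    ring
  have hprod : ∀ (ρ₁ : Matrix m₁ m₁ ℂ) (ρ₂ : Matrix m₂ m₂ ℂ), W * (ρ₁ ⊗ₖ ρ₂).submatrix fm fm * Wᴴ =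
      ((V₁ * ρ₁ * V₁ᴴ) ⊗ₖ (V₂ * ρ₂ * V₂ᴴ)).submatrix s s := by
    intro ρ₁ ρ₂
    rw [hW, conjTranspose_submatrix, submatrix_mul_equiv, submatrix_mul_equiv,
      conjTranspose_kronecker, ← mul_kronecker_mul, ← mul_kronecker_mul]
  let Ψ : Matrix m m ℂ →ₗ[ℂ] Matrix (e₁ × e₂) (e₁ × e₂) ℂ :=
    { toFun := fun X => traceLeft (W * X * Wᴴ)
      map_add' := fun X Y => by
        ext a b
        simp [traceLeft, Matrix.mul_add, Matrix.add_mul, Finset.sum_add_distrib]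
      map_smul' := fun c X => by
        ext a b
        simp [traceLeft, Finset.mul_sum] }
  refine ⟨Ψ, isComplementary_of_isometry W hWW hΦW fun X => rfl, fun ρ₁ ρ₂ => ⟨?_, ?_⟩⟩
  · rw [hΦW, hprod, hs, traceRight_kronecker_submatrix, ← (hc₁ ρ₁).1, ← (hc₂ ρ₂).1]
  · change traceLeft _ = _
    rw [hprod, hs, traceLeft_kronecker_submatrix, ← (hc₁ ρ₁).2, ← (hc₂ ρ₂).2]

end Product

/-! ### Superadditivity and existence of the capacity. -/

section Capacity

variable {m n : Type*} [Fintype m] [DecidableEq m] [Fintype n] [DecidableEq n]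

theorem isState_maximallyMixed [Nonempty m] :
    IsState (((Fintype.card m : ℂ)⁻¹) • (1 : Matrix m m ℂ)) := by
  refine ⟨PosSemidef.one.smul ?_, ?_⟩
  · simp
  · simp [trace_smul]

theorem IsComplementary.coherentInfoAt_le {e : Type*} [Fintype e] [DecidableEq e]
    {Φ : Matrix m m ℂ →ₗ[ℂ] Matrix n n ℂ} {Ψ : Matrix m m ℂ →ₗ[ℂ] Matrix e e ℂ}
    (h : IsComplementary Φ Ψ) {ρ : Matrix m m ℂ} (hρ : IsState ρ) :
    coherentInfoAt Φ Ψ ρ ≤ Real.log (Fintype.card n) := by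
  have h1 := (h.isState hρ).entropy_le_log_card
  have h2 := (h.symm.isState hρ).entropy_nonneg
  rw [coherentInfoAt]
  linarith

theorem IsComplementary.coherentInfoAt_le_coherentInformation {e : Type} [Fintype e]
    [DecidableEq e] {Φ : Matrix m m ℂ →ₗ[ℂ] Matrix n n ℂ} {Ψ : Matrix m m ℂ →ₗ[ℂ] Matrix e e ℂ}
    (h : IsComplementary Φ Ψ) {ρ : Matrix m m ℂ} (hρ : IsState ρ) :
    coherentInfoAt Φ Ψ ρ ≤ coherentInformation Φ := by
  refine le_csSup ⟨Real.log (Fintype.card n), ?_⟩ ⟨e, _, _, Ψ, ρ, h, hρ, rfl⟩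
  rintro x ⟨e', _, _, Ψ', ρ', h', hρ', rfl⟩
  exact h'.coherentInfoAt_le hρ'

/-- The given complementary channel makes the set under the supremum nonempty. -/
theorem IsComplementary.coherentInformation_le [Nonempty m] {e : Type} [Fintype e]
    {Φ : Matrix m m ℂ →ₗ[ℂ] Matrix n n ℂ}
    {Ψ : Matrix m m ℂ →ₗ[ℂ] Matrix e e ℂ} (h : IsComplementary Φ Ψ) {c : ℝ}
    (hc : ∀ (e' : Type) [Fintype e'] [DecidableEq e'] (Ψ' : Matrix m m ℂ →ₗ[ℂ] Matrix e' e' ℂ)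
      (ρ : Matrix m m ℂ), IsComplementary Φ Ψ' → IsState ρ → coherentInfoAt Φ Ψ' ρ ≤ c) :
    coherentInformation Φ ≤ c := by
  classical
  refine csSup_le ⟨_, e, _, inferInstance, Ψ, _, h, isState_maximallyMixed, rfl⟩ ?_
  rintro x ⟨e', _, _, Ψ', ρ', h', hρ', rfl⟩
  exact hc e' Ψ' ρ' h' hρ'

/-- The coherent information is superadditive on tensor powers. -/
theorem IsComplementary.coherentInformation_add_le [Nonempty m] {e : Type} [Fintype e]
    {Φ : Matrix m m ℂ →ₗ[ℂ] Matrix n n ℂ} {Ψ : Matrix m m ℂ →ₗ[ℂ] Matrix e e ℂ}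
    (h : IsComplementary Φ Ψ) (M N : ℕ) :
    coherentInformation (QuantumInfo.tensorPower Φ M) +
      coherentInformation (QuantumInfo.tensorPower Φ N) ≤
        coherentInformation (QuantumInfo.tensorPower Φ (M + N)) := by
  -- The two suprema are bounded one at a time. `Ψ₁` and `Ψ₂` are arbitrary complements of the
  -- tensor powers, not necessarily tensor powers themselves.
  rw [← le_sub_iff_add_le]
  refine (h.tensorPower M).coherentInformation_le fun e₁ _ _ Ψ₁ ρ₁ h₁ hρ₁ => ?_
  rw [le_sub_comm]
  refine (h.tensorPower N).coherentInformation_le fun e₂ _ _ Ψ₂ ρ₂ h₂ hρ₂ => ?_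
  rw [le_sub_iff_add_le']
  obtain ⟨Ψ', hΨ', hout⟩ := h₁.exists_kronecker h₂ (QuantumInfo.tensorPower Φ (M + N))
    (Fin.appendEquiv M N).symm (Fin.appendEquiv M N).symm fun i j a b => by
      simp only [tensorPower_single, Fin.prod_univ_add, Fin.appendEquiv_symm_apply]
  refine le_trans (le_of_eq ?_) (hΨ'.coherentInfoAt_le_coherentInformation
    ((hρ₁.kronecker hρ₂).submatrix_equiv (Fin.appendEquiv M N).symm))
  have hs₁ := h₁.isState hρ₁
  have hs₂ := h₂.isState hρ₂
  simp only [coherentInfoAt]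
  rw [(hout ρ₁ ρ₂).1, (hout ρ₁ ρ₂).2, entropy_submatrix_equiv (hs₁.kronecker hs₂).1.1,
    entropy_kronecker hs₁ hs₂, entropy_kronecker (h₁.symm.isState hρ₁) (h₂.symm.isState hρ₂)]
  ring

/-- The quantum capacity exists and is at least the coherent information of a single use. -/
theorem IsComplementary.exists_hasQuantumCapacity [Nonempty m] {e : Type} [Fintype e]
    {Φ : Matrix m m ℂ →ₗ[ℂ] Matrix n n ℂ} {Ψ : Matrix m m ℂ →ₗ[ℂ] Matrix e e ℂ}
    (h : IsComplementary Φ Ψ) :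
    ∃ q : ℝ, HasQuantumCapacity Φ q ∧
      coherentInformation (QuantumInfo.tensorPower Φ 1) ≤ q := by
  -- Fekete's lemma is stated for subadditive sequences, hence the sign.
  have hsub : Subadditive fun N : ℕ => -coherentInformation (QuantumInfo.tensorPower Φ N) := by
    intro M N
    have := h.coherentInformation_add_le M N
    linarith
  have hbdd : BddBelow (Set.range fun N : ℕ =>
      -coherentInformation (QuantumInfo.tensorPower Φ N) / N) := by
    refine ⟨-Real.log (Fintype.card n), ?_⟩
    rintro _ ⟨N, rfl⟩
    have hle : coherentInformation (QuantumInfo.tensorPower Φ N) ≤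
        N * Real.log (Fintype.card n) := by
      refine (h.tensorPower N).coherentInformation_le fun e' _ _ Ψ' ρ h' hρ => ?_
      refine (h'.coherentInfoAt_le hρ).trans (le_of_eq ?_)
      simp
    -- At `N = 0` the quotient is `0` by convention, and the bound holds because the logarithm of a
    -- natural number is nonnegative.
    rcases N.eq_zero_or_pos with rfl | hN
    · simpa using Real.log_natCast_nonneg (Fintype.card n)
    · have hN' : (0 : ℝ) < N := Nat.cast_pos.2 hN
      rw [le_div_iff₀ hN']
      linarith
  refine ⟨-hsub.lim, ?_, ?_⟩
  · have := (hsub.tendsto_lim hbdd).neg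
    refine this.congr fun N => ?_
    rw [neg_div, neg_neg]
  -- The Fekete limit is an infimum of the quotients; the term at `1` gives the bound.
  · have := hsub.lim_le_div hbdd one_ne_zero
    simp only [Nat.cast_one, div_one] at this
    linarith

/-- The first tensor power is indexed by `Fin 1 → m` rather than `m`; this identifies it with the
channel itself. -/
theorem tensorPower_one_submatrix {m n : Type*} [Fintype m] [DecidableEq m]
    (Φ : Matrix m m ℂ →ₗ[ℂ] Matrix n n ℂ) (X : Matrix m m ℂ) :
    QuantumInfo.tensorPower Φ 1 (X.submatrix (Equiv.funUnique (Fin 1) m)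
      (Equiv.funUnique (Fin 1) m)) =
        (Φ X).submatrix (Equiv.funUnique (Fin 1) n) (Equiv.funUnique (Fin 1) n) := by
  have := tensorPower_prod Φ 1 fun _ => X
  simpa [Matrix.submatrix, Equiv.funUnique] using this

theorem IsComplementary.coherentInfoAt_le_tensorPower_one {e : Type} [Fintype e] [DecidableEq e]
    {Φ : Matrix m m ℂ →ₗ[ℂ] Matrix n n ℂ} {Ψ : Matrix m m ℂ →ₗ[ℂ] Matrix e e ℂ}
    (h : IsComplementary Φ Ψ) {ρ : Matrix m m ℂ} (hρ : IsState ρ) :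
    coherentInfoAt Φ Ψ ρ ≤ coherentInformation (QuantumInfo.tensorPower Φ 1) := by
  refine le_trans (le_of_eq ?_) ((h.tensorPower 1).coherentInfoAt_le_coherentInformation
    (hρ.submatrix_equiv (Equiv.funUnique (Fin 1) m)))
  simp only [coherentInfoAt]
  rw [tensorPower_one_submatrix, tensorPower_one_submatrix,
    entropy_submatrix_equiv (h.isState hρ).1.1, entropy_submatrix_equiv (h.symm.isState hρ).1.1]

end Capacity

/-! ### The two output entropies at the maximally mixed state. -/

section WernerHolevo

theorem wernerHolevo_one {d : ℕ} (hd : 2 ≤ d) : wernerHolevo d 1 = 1 := by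
  have h1 : (d : ℂ) - 1 ≠ 0 := by
    rw [sub_ne_zero]
    exact_mod_cast (by omega : d ≠ 1)
  ext i j
  simp only [wernerHolevo, LinearMap.coe_mk, AddHom.coe_mk, trace_one, Fintype.card_fin,
    transpose_one, Matrix.smul_apply, Matrix.sub_apply, smul_eq_mul]
  field_simp

theorem entropy_wernerHolevo_maximallyMixed {d : ℕ} (hd : 2 ≤ d) :
    entropy (wernerHolevo d ((d : ℂ)⁻¹ • 1)) = Real.log d := by
  have : NeZero d := ⟨by omega⟩
  have hs := isState_maximallyMixed (m := Fin d)
  rw [Fintype.card_fin] at hs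
  rw [map_smul, wernerHolevo_one hd, hs.entropy_eq_neg_log (c := (d : ℝ)⁻¹), Real.log_inv, neg_neg]
  simp [smul_smul]

/-- The Choi matrix of the Werner-Holevo channel is a multiple of a projection. -/
theorem choi_wernerHolevo_mul_self (d : ℕ) {J : Matrix (Fin d × Fin d) (Fin d × Fin d) ℂ}
    (hJ : ∀ a i b j, J (a, i) (b, j) = wernerHolevo d (single i j 1) a b) :
    J * J = (2 * ((d : ℂ) - 1)⁻¹) • J := by
  -- `F` is the flip of the two tensor factors; `F² = 1` yields `(1 - F)² = 2(1 - F)`.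
  set F : Matrix (Fin d × Fin d) (Fin d × Fin d) ℂ :=
    (1 : Matrix (Fin d × Fin d) (Fin d × Fin d) ℂ).submatrix id (Equiv.prodComm _ _) with hF
  have hFF : F * F = 1 := by
    ext p q
    simp [hF, mul_apply, one_apply, Prod.ext_iff, Fintype.sum_prod_type, ite_and, eq_comm]
  have hJF : J = ((d : ℂ) - 1)⁻¹ • (1 - F) := by
    ext ⟨a, i⟩ ⟨b, j⟩
    rw [hJ]
    have htr : (single i j (1 : ℂ)).trace = if i = j then 1 else 0 := by
      split_ifs with h
      · simp [h]
      · exact trace_single_eq_of_ne i j 1 h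
    simp only [wernerHolevo, LinearMap.coe_mk, AddHom.coe_mk, htr, hF, Matrix.smul_apply,
      Matrix.sub_apply, smul_eq_mul, transpose_apply, submatrix_apply, one_apply, single_apply,
      Equiv.prodComm_apply, Prod.swap_prod_mk, Prod.mk.injEq, id]
    congr 2
    · simp [ite_and]
    · simp [and_comm, eq_comm]
  rw [hJF, Matrix.smul_mul, Matrix.mul_smul, sub_mul, mul_sub, mul_sub, hFF, one_mul, one_mul,
    mul_one, smul_smul, smul_smul]
  module

theorem entropy_complementary_wernerHolevo_maximallyMixed {d : ℕ} (hd : 2 ≤ d) {e : Type*}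
    [Fintype e] [DecidableEq e] {Φc : Matrix (Fin d) (Fin d) ℂ →ₗ[ℂ] Matrix e e ℂ}
    (h : IsComplementary (wernerHolevo d) Φc) :
    entropy (Φc ((d : ℂ)⁻¹ • 1)) = Real.log (d * (d - 1) / 2) := by
  have : NeZero d := ⟨by omega⟩
  have hs := isState_maximallyMixed (m := Fin d)
  rw [Fintype.card_fin] at hs
  have hc := h.symm.isState hs
  obtain ⟨-, -, V, -, hV⟩ := h
  -- `A` reshapes the isometry, grouping output with input against the environment. The conjugate
  -- makes `Φc 1` equal to `Aᴴ * A`, at the price of a transpose on the Choi matrix.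
  set A : Matrix (Fin d × Fin d) e ℂ := of fun p c => star (V (p.1, c) p.2) with hA
  have hG : Φc 1 = Aᴴ * A := by
    rw [(hV 1).2]
    ext c c'
    simp [traceLeft, hA, mul_apply, Fintype.sum_prod_type]
  have hJ := choi_wernerHolevo_mul_self d (J := (A * Aᴴ)ᵀ) fun a i b j => by
    rw [apply_single_of_traceRight fun X => (hV X).1]
    simp [hA, mul_apply, mul_comm]
  have hJ' : A * Aᴴ * (A * Aᴴ) = (2 * ((d : ℂ) - 1)⁻¹) • (A * Aᴴ) := by
    rw [← transpose_mul, ← transpose_smul] at hJ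
    exact transpose_injective hJ
  -- Sandwiching the quadratic relation for `A * Aᴴ` between `Aᴴ` and `A` turns it into a cubic one
  -- for `Aᴴ * A`.
  have hG3 : Φc 1 * Φc 1 * Φc 1 = (2 * ((d : ℂ) - 1)⁻¹) • (Φc 1 * Φc 1) := by
    calc Φc 1 * Φc 1 * Φc 1 = Aᴴ * (A * Aᴴ * (A * Aᴴ)) * A := by
          rw [hG]
          simp only [Matrix.mul_assoc]
      _ = _ := by
          rw [hJ', hG, Matrix.mul_smul, Matrix.smul_mul]
          simp only [Matrix.mul_assoc]
  have hd' : (d : ℝ) * (d - 1) / 2 = ((d : ℝ)⁻¹ * (2 * ((d : ℝ) - 1)⁻¹))⁻¹ := by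
    simp only [_root_.mul_inv_rev, inv_inv]
    ring
  rw [hc.entropy_eq_neg_log (c := (d : ℝ)⁻¹ * (2 * ((d : ℝ) - 1)⁻¹)), ← Real.log_inv, hd']
  simp only [map_smul, Matrix.mul_smul, Matrix.smul_mul, hG3, smul_smul]
  congr 1
  push_cast
  ring

end WernerHolevo

end QuantumInfo

theorem theorem4p3 (d : ℕ) (hd : 4 ≤ d) {e : Type*} [Fintype e] [DecidableEq e]
    (Φc : Matrix (Fin d) (Fin d) ℂ →ₗ[ℂ] Matrix e e ℂ)
    (hΦc : QuantumInfo.IsComplementary (QuantumInfo.wernerHolevo d) Φc) :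
    ∃ q : ℝ, QuantumInfo.HasQuantumCapacity Φc q ∧ 0 < q := by
  have : NeZero d := ⟨by omega⟩
  -- By symmetry the Werner–Holevo channel is itself the complement of `Φc`.
  obtain ⟨q, hq, hle⟩ := hΦc.symm.exists_hasQuantumCapacity
  refine ⟨q, hq, lt_of_lt_of_le ?_ hle⟩
  have hs := QuantumInfo.isState_maximallyMixed (m := Fin d)
  rw [Fintype.card_fin] at hs
  refine lt_of_lt_of_le ?_ (hΦc.symm.coherentInfoAt_le_tensorPower_one hs)
  rw [QuantumInfo.coherentInfoAt,
    QuantumInfo.entropy_complementary_wernerHolevo_maximallyMixed (by omega) hΦc,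
    QuantumInfo.entropy_wernerHolevo_maximallyMixed (by omega), sub_pos]
  have hd4 : (4 : ℝ) ≤ d := by exact_mod_cast hd
  -- `d < d(d-1)/2` amounts to `d > 3`; this is where `4 ≤ d` is needed.
  exact Real.log_lt_log (by linarith) (by nlinarith)
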